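/- Let $M$ be a smooth real supermanifold of dimension $(p|q)$ with body $|M|$ and structure sheaf $\mathcal O_M$, and let $\nabla$ be a weight vector field on $M$, i.e. an even vector field such that around every point of $|M|$ there are local coordinates $(x^i)$ (some even, some odd) and real numbers $w_i$ with $\nabla(x^i)=w_i x^i$. A vector field $X$ (resp. a one-form $\alpha$) on $M$ is called homogeneous of degree $(\sigma,w)\in\mathbb Z_2\times\mathbb R$ if it has parity $\sigma$ and $[\nabla,X]=w X$ (resp. $\mathcal L_\nabla\alpha=w\alpha$). Contractions are left linear, $i_{fX}\alpha=f\,i_X\alpha$; the parity of forms and the Cartan calculus follow Deligne's sign convention, so that $\mathrm d$ is even; and $\ker \mathrm d\alpha$ consists of the vector fields $X$ with $i_X\mathrm d\alpha=0$. A one-form $\alpha$ on $M$ is called a contact form if (a) it is non-degenerate, i.e. its characteristic set $\chi(\alpha)=\ker\alpha\cap\ker\mathrm d\alpha\subseteq \mathsf TM$ is the zero section: at every $m\in|M|$ the only tangent vector $v\in\mathsf T_mM$ with $i_v\alpha_m=0$ and $i_v(\mathrm d\alpha)_m=0$ is $v=0$; and (b) the morphism $\flat_{\mathrm d\alpha}\colon\mathsf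 TM\to\mathsf T^*M$, $v\mapsto i_v\mathrm d\alpha$, of vector superbundles has constant rank $p+q-1$, i.e. around every point its matrix in suitable local homogeneous frames of $\mathsf TM$ and $\mathsf T^*M$ is the diagonal matrix $\operatorname{diag}(1,\dots,1,0)$ with $p+q-1$ ones. Let $\alpha$ be a contact form on $M$ which is homogeneous of degree $(\sigma,w)\in\mathbb Z_2\times\mathbb R$. Then there is a unique vector field $R$ on $M$ such that $$i_R\alpha=1,\qquad R\in\ker\mathrm d\alpha .$$ Moreover, $R$ is nowhere vanishing (its value in $\mathsf T_mM$ is non-zero for every $m\in|M|$) and homogeneous of degree $(\sigma,-w)$. -/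

import Mathlib

open CategoryTheory TopologicalSpace Opposite
open scoped Manifold ContDiff TensorProduct

noncomputable section

namespace SuperGeom

universe u

/-- The sign `(-1)^(i j)` for parities `i j : ZMod 2`. -/
def koszul (i j : ZMod 2) : ℝ := if i = 1 ∧ j = 1 then -1 else 1

theorem koszul_add_right (i j k : ZMod 2) : koszul i (j + k) = koszul i j * koszul i k := by
  have h : ∀ a : ZMod 2, a = 0 ∨ a = 1 := by decide
  have h2 : (1 + 1 : ZMod 2) = 0 := by decide
  rcases h i with rfl | rfl <;> rcases h j with rfl | rfl <;> rcases h k with rfl | rfl <;>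
    simp [koszul, h2]

theorem koszul_add_left (i j k : ZMod 2) : koszul (i + j) k = koszul i k * koszul j k := by
  have h : ∀ a : ZMod 2, a = 0 ∨ a = 1 := by decide
  have h2 : (1 + 1 : ZMod 2) = 0 := by decide
  rcases h i with rfl | rfl <;> rcases h j with rfl | rfl <;> rcases h k with rfl | rfl <;>
    simp [koszul, h2]

theorem koszul_comm (i j : ZMod 2) : koszul i j = koszul j i := by
  simp [koszul, and_comm]

theorem koszul_mul_self (i j : ZMod 2) : koszul i j * koszul i j = 1 := by
  unfold koszul; split_ifs <;> norm_num

/-- A topological space with a sheaf of supercommutative real superalgebras. -/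
structure SuperSpace : Type (u + 1) where
  carrier : TopCat.{u}
  sheaf : TopCat.Sheaf (AlgCat.{u} ℝ) carrier
  /-- the parity `i` part of the algebra of sections -/
  parity : ∀ U : Opens carrier, ZMod 2 → Submodule ℝ (sheaf.presheaf.obj (op U))
  graded : ∀ U : Opens carrier, GradedAlgebra (parity U)
  map_parity : ∀ {U V : Opens carrier} (h : V ≤ U) (i : ZMod 2)
    (f : sheaf.presheaf.obj (op U)), f ∈ parity U i →
      (sheaf.presheaf.map (homOfLE h).op).hom f ∈ parity V i
  supercomm : ∀ (U : Opens carrier) (i j : ZMod 2) (f g : sheaf.presheaf.obj (op U)),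
    f ∈ parity U i → g ∈ parity U j → f * g = koszul i j • (g * f)

namespace SuperSpace

variable (M : SuperSpace.{u})

/-- Superfunctions on the open set `U`. -/
abbrev O (U : Opens M.carrier) : Type u := M.sheaf.presheaf.obj (op U)

instance (U : Opens M.carrier) : GradedAlgebra (M.parity U) := M.graded U

variable {M}

/-- Restriction of superfunctions. -/
def res {U V : Opens M.carrier} (h : V ≤ U) : M.O U →ₐ[ℝ] M.O V :=
  (M.sheaf.presheaf.map (homOfLE h).op).hom

theorem res_res {U V W : Opens M.carrier} (h : V ≤ U) (h' : W ≤ V) (f : M.O U) :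
    res h' (res h f) = res (h'.trans h) f := by
  have : M.sheaf.presheaf.map (homOfLE (h'.trans h)).op =
      M.sheaf.presheaf.map (homOfLE h).op ≫ M.sheaf.presheaf.map (homOfLE h').op := by
    rw [← Functor.map_comp]; rfl
  unfold res
  rw [this]; rfl

/-- The parity `i` component of a superfunction. -/
def part {U : Opens M.carrier} (i : ZMod 2) (f : M.O U) : M.O U :=
  (DirectSum.decompose (M.parity U) f i : M.O U)

theorem part_mem {U : Opens M.carrier} (i : ZMod 2) (f : M.O U) :
    part i f ∈ M.parity U i := (DirectSum.decompose (M.parity U) f i).2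

/-- The germ of `f` at `m` lies in the maximal ideal of the local ring of germs at `m`,
i.e. `f` is not invertible on any neighbourhood of `m`. -/
def FunVanishesAt {U : Opens M.carrier} (f : M.O U) (m : M.carrier) : Prop :=
  ∀ (V : Opens M.carrier) (h : V ≤ U), m ∈ V → ¬ IsUnit (res h f)

variable (M)

/-- Vector fields of parity `s` on `U`: superderivations of parity `s` of the sheaf of
superfunctions restricted to `U`. -/
def HomVF (U : Opens M.carrier) (s : ZMod 2) :
    Submodule ℝ (∀ V : {V : Opens M.carrier // V ≤ U}, M.O V.1 →ₗ[ℝ] M.O V.1) where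
  carrier := {D |
    (∀ (V W : {V : Opens M.carrier // V ≤ U}) (h : W.1 ≤ V.1) (f : M.O V.1),
      res h (D V f) = D W (res h f)) ∧
    (∀ (V : {V : Opens M.carrier // V ≤ U}) (i : ZMod 2) (f : M.O V.1),
      f ∈ M.parity V.1 i → D V f ∈ M.parity V.1 (s + i)) ∧
    (∀ (V : {V : Opens M.carrier // V ≤ U}) (i : ZMod 2) (f g : M.O V.1),
      f ∈ M.parity V.1 i → D V (f * g) = D V f * g + koszul s i • (f * D V g))}
  zero_mem' := by
    refine ⟨fun V W h f => by simp, fun V i f _ => by simp, fun V i f g _ => by simp⟩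
  add_mem' := by
    rintro D E ⟨hD1, hD2, hD3⟩ ⟨hE1, hE2, hE3⟩
    refine ⟨fun V W h f => by simp [hD1 V W h, hE1 V W h],
      fun V i f hf => add_mem (hD2 V i f hf) (hE2 V i f hf), fun V i f g hf => ?_⟩
    simp only [Pi.add_apply, LinearMap.add_apply, hD3 V i f g hf, hE3 V i f g hf, add_mul, mul_add,
      smul_add]
    abel
  smul_mem' := by
    rintro c D ⟨hD1, hD2, hD3⟩
    refine ⟨fun V W h f => by simp [hD1 V W h],
      fun V i f hf => Submodule.smul_mem _ c (hD2 V i f hf), fun V i f g hf => ?_⟩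
    simp only [Pi.smul_apply, LinearMap.smul_apply, hD3 V i f g hf, smul_add, smul_mul_assoc,
      mul_smul_comm]
    rw [smul_comm]

/-- Vector fields on `U`; the component `X s` is the part of `X` of parity `s`. -/
abbrev VF (U : Opens M.carrier) : Type u := ∀ s : ZMod 2, M.HomVF U s

variable {M}

/-- A homogeneous vector field viewed as a vector field. -/
def ofHom {U : Opens M.carrier} (s : ZMod 2) (D : M.HomVF U s) : M.VF U := Pi.single s D

/-- `X` has parity `s`. -/
def VFHasParity {U : Opens M.carrier} (X : M.VF U) (s : ZMod 2) : Prop :=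
  ∀ t, t ≠ s → X t = 0

/-- The action of a vector field on superfunctions. -/
def VF.act {U : Opens M.carrier} (X : M.VF U) (f : M.O U) : M.O U :=
  ∑ s : ZMod 2, (X s).1 ⟨U, le_rfl⟩ f

/-- Restriction of vector fields. -/
def resVF {U V : Opens M.carrier} (h : V ≤ U) (X : M.VF U) : M.VF V := fun s =>
  ⟨fun W => (X s).1 ⟨W.1, W.2.trans h⟩,
    fun W W' => (X s).2.1 ⟨W.1, W.2.trans h⟩ ⟨W'.1, W'.2.trans h⟩,
    fun W => (X s).2.2.1 ⟨W.1, W.2.trans h⟩,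
    fun W => (X s).2.2.2 ⟨W.1, W.2.trans h⟩⟩

theorem mul_mem_HomVF {U : Opens M.carrier} {s t : ZMod 2} {f : M.O U}
    (hf : f ∈ M.parity U s) (D : M.HomVF U t) :
    (fun V : {V : Opens M.carrier // V ≤ U} =>
      (LinearMap.mulLeft ℝ (res V.2 f)) ∘ₗ D.1 V) ∈ M.HomVF U (s + t) := by
  obtain ⟨D, hD1, hD2, hD3⟩ := D
  refine ⟨fun V W h g => ?_, fun V i g hg => ?_, fun V i g k hg => ?_⟩
  · simp [hD1 V W h, res_res]
  · rw [add_assoc]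
    exact SetLike.mul_mem_graded (M.map_parity V.2 s f hf) (hD2 V i g hg)
  · have hc := M.supercomm V.1 s i (res V.2 f) g (M.map_parity V.2 s f hf) hg
    simp only [LinearMap.comp_apply, LinearMap.mulLeft_apply, hD3 V i g k hg, mul_add,
      mul_smul_comm]
    rw [← mul_assoc, ← mul_assoc, hc, koszul_add_left]
    simp only [smul_mul_assoc, smul_smul, mul_assoc]
    rw [mul_comm (koszul s i)]

/-- Left multiplication of a vector field by a superfunction, `(f X) g = f (X g)`. -/
def smulVF {U : Opens M.carrier} (f : M.O U) (X : M.VF U) : M.VF U := fun r =>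
  ∑ s : ZMod 2, ⟨fun V => LinearMap.mulLeft ℝ (res V.2 (part s f)) ∘ₗ (X (r - s)).1 V, by
    have h := mul_mem_HomVF (part_mem s f) (X (r - s))
    rwa [add_sub_cancel] at h⟩

theorem bracket_mem_HomVF {U : Opens M.carrier} {s t : ZMod 2}
    (D : M.HomVF U s) (E : M.HomVF U t) :
    (fun V : {V : Opens M.carrier // V ≤ U} =>
      D.1 V ∘ₗ E.1 V - koszul s t • (E.1 V ∘ₗ D.1 V)) ∈ M.HomVF U (s + t) := by
  obtain ⟨D, hD1, hD2, hD3⟩ := D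
  obtain ⟨E, hE1, hE2, hE3⟩ := E
  refine ⟨fun V W h g => ?_, fun V i g hg => ?_, fun V i g k hg => ?_⟩
  · simp [hD1 V W h, hE1 V W h]
  · refine sub_mem ?_ (Submodule.smul_mem _ _ ?_)
    · have := hD2 V _ _ (hE2 V i g hg)
      rwa [← add_assoc] at this
    · have := hE2 V _ _ (hD2 V i g hg)
      rwa [← add_assoc, add_comm t s] at this
  · simp only [LinearMap.sub_apply, LinearMap.smul_apply, LinearMap.comp_apply,
      hD3 V i g k hg, hE3 V i g k hg, map_add, map_smul,
      hD3 V _ _ k (hE2 V i g hg), hE3 V _ _ k (hD2 V i g hg), hD3 V i g _ hg, hE3 V i g _ hg,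
      koszul_add_right, koszul_add_left, koszul_comm t s, sub_mul, mul_sub,
      smul_add, smul_sub, smul_smul, smul_mul_assoc, mul_smul_comm]
    have h1 : koszul s t * (koszul s t * koszul t i) = koszul t i := by
      rw [← mul_assoc, koszul_mul_self, one_mul]
    rw [h1, show koszul s t * (koszul s i * koszul t i) =
      koszul s i * koszul t i * koszul s t by ring, mul_comm (koszul t i) (koszul s i)]
    abel_nf

/-- The Lie superbracket `[D, E] = D E - (-1)^(s t) E D` of homogeneous vector fields, extended
biadditively to all vector fields. -/
def bracket {U : Opens M.carrier} (X Y : M.VF U) : M.VF U := fun r =>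
  ∑ s : ZMod 2, ⟨fun V => (X s).1 V ∘ₗ (Y (r - s)).1 V
      - koszul s (r - s) • ((Y (r - s)).1 V ∘ₗ (X s).1 V), by
    have h := bracket_mem_HomVF (X s) (Y (r - s))
    rwa [add_sub_cancel] at h⟩

/-- The value of the vector field `X` in the fibre of the tangent bundle at `m` is zero: near `m`,
`X` is a combination of vector fields with coefficients in the maximal ideal at `m`. -/
def VFVanishesAt {U : Opens M.carrier} (X : M.VF U) (m : M.carrier) : Prop :=
  ∃ (V : Opens M.carrier) (h : V ≤ U) (k : ℕ) (f : Fin k → M.O V) (Y : Fin k → M.VF V),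
    m ∈ V ∧ (∀ i, FunVanishesAt (f i) m) ∧ resVF h X = ∑ i, smulVF (f i) (Y i)

/-- The homogeneous vector fields `X i` are free generators of the tangent sheaf over `U`. -/
def IsFrame {U : Opens M.carrier} {n : ℕ} (X : Fin n → M.VF U) : Prop :=
  (∀ i, ∃ s, VFHasParity (X i) s) ∧
  ∀ (V : Opens M.carrier) (h : V ≤ U) (Z : M.VF V),
    ∃! c : Fin n → M.O V, Z = ∑ i, smulVF (c i) (resVF h (X i))

variable (M)

/-- Differential one-forms on `M`: morphisms from the tangent sheaf to the sheaf of superfunctions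
which are linear over superfunctions, `X ↦ i_X α` with `i_{fX} α = f (i_X α)`. -/
structure OneForm where
  contr : ∀ {U : Opens M.carrier}, M.VF U →ₗ[ℝ] M.O U
  contr_smul : ∀ {U : Opens M.carrier} (f : M.O U) (X : M.VF U),
    contr (smulVF f X) = f * contr X
  contr_res : ∀ {U V : Opens M.carrier} (h : V ≤ U) (X : M.VF U),
    contr (resVF h X) = res h (contr X)

namespace OneForm

variable {M}
variable (α : M.OneForm)

/-- `α` has parity `σ`: contraction with a vector field of parity `s` has parity `s + σ`. -/
def HasParity (σ : ZMod 2) : Prop :=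
  ∀ (U : Opens M.carrier) (s : ZMod 2) (D : M.HomVF U s),
    α.contr (ofHom s D) ∈ M.parity U (s + σ)

/-- The double contraction `i_Y i_X dα`. For `X`, `Y` of parities `s`, `t`, Cartan's formulas
`L_X = i_X d + d i_X`, `i_{[X,Y]} = L_X i_Y - (-1)^(s t) i_Y L_X`, `i_Y df = Y f` give
`i_Y i_X dα = (-1)^(s t) X (i_Y α) - Y (i_X α) - (-1)^(s t) i_{[X,Y]} α`. -/
def dContr {U : Opens M.carrier} (X Y : M.VF U) : M.O U :=
  ∑ s : ZMod 2, ∑ t : ZMod 2,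
    (koszul s t • (ofHom s (X s)).act (α.contr (ofHom t (Y t)))
      - (ofHom t (Y t)).act (α.contr (ofHom s (X s)))
      - koszul s t • α.contr (bracket (ofHom s (X s)) (ofHom t (Y t))))

/-- `X ∈ ker dα`, i.e. the one-form `i_X dα` is zero. -/
def MemKerD {U : Opens M.carrier} (X : M.VF U) : Prop :=
  ∀ (V : Opens M.carrier) (h : V ≤ U) (Y : M.VF V), α.dContr (resVF h X) Y = 0

/-- The contraction `i_X (L_N α) = N (i_X α) - i_{[N,X]} α` of the Lie derivative of `α` along an
even vector field `N`. -/
def lieContr (N : M.HomVF ⊤ 0) {U : Opens M.carrier} (X : M.VF U) : M.O U :=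
  (resVF le_top (ofHom 0 N)).act (α.contr X) - α.contr (bracket (resVF le_top (ofHom 0 N)) X)

/-- `L_N α = w α`. -/
def HasWeight (N : M.HomVF ⊤ 0) (w : ℝ) : Prop :=
  ∀ (U : Opens M.carrier) (X : M.VF U), α.lieContr N X = w • α.contr X

/-- The value of `X` at `m` belongs to the fibre at `m` of the characteristic set
`ker α ∩ ker dα` in the tangent bundle. -/
def CharAt {U : Opens M.carrier} (X : M.VF U) (m : M.carrier) : Prop :=
  FunVanishesAt (α.contr X) m ∧
  ∀ (V : Opens M.carrier) (h : V ≤ U), m ∈ V → ∀ Y : M.VF V,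
    FunVanishesAt (α.dContr (resVF h X) Y) m

/-- The characteristic set `ker α ∩ ker dα` is the zero section of the tangent bundle. -/
def IsNondegenerate : Prop :=
  ∀ (m : M.carrier) (U : Opens M.carrier) (X : M.VF U), m ∈ U → α.CharAt X m → VFVanishesAt X m

/-- The morphism `X ↦ i_X dα` from the tangent to the cotangent bundle of a supermanifold of total
dimension `n` has constant rank `r`: around every point its matrix with respect to suitable
homogeneous frames (`X` of the tangent bundle, and the dual of `Y` in the cotangent bundle) is
the diagonal matrix with `r` ones followed by zeros. -/
def DHasRank (n r : ℕ) : Prop :=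
  r ≤ n ∧ ∀ m : M.carrier, ∃ (U : Opens M.carrier) (X Y : Fin n → M.VF U),
    m ∈ U ∧ IsFrame X ∧ IsFrame Y ∧
      ∀ i j, α.dContr (X i) (Y j) = if i = j ∧ (i : ℕ) < r then 1 else 0

end OneForm

/-- `[N, X] = w X`, i.e. `X` has weight `w` with respect to the even vector field `N`. -/
def VFHasWeight {M : SuperSpace.{u}} (N : M.HomVF ⊤ 0) (X : M.VF ⊤) (w : ℝ) : Prop :=
  bracket (ofHom 0 N) X = w • X

end SuperSpace

/-- Smooth functions on an open subset of `ℝ^p`. -/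
abbrev Smooth {p : ℕ} (V : Opens (EuclideanSpace ℝ (Fin p))) : Type :=
  C^∞⟮𝓘(ℝ, EuclideanSpace ℝ (Fin p)), V; 𝓘(ℝ, ℝ), ℝ⟯

/-- Restriction of smooth functions. -/
def smoothRes {p : ℕ} {V W : Opens (EuclideanSpace ℝ (Fin p))} (h : W ≤ V) :
    Smooth V →ₐ[ℝ] Smooth W :=
  { ContMDiffMap.restrictRingHom 𝓘(ℝ, EuclideanSpace ℝ (Fin p)) 𝓘(ℝ, ℝ) ℝ h with
    commutes' := fun _ => rfl }

/-- The exterior algebra on `q` generators. -/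
abbrev Grassmann (q : ℕ) : Type := ExteriorAlgebra ℝ (Fin q → ℝ)

/-- Superfunctions on the open subset `V` of `ℝ^{p|q}`. -/
abbrev Model {p : ℕ} (q : ℕ) (V : Opens (EuclideanSpace ℝ (Fin p))) : Type :=
  Smooth V ⊗[ℝ] Grassmann q

/-- Restriction of superfunctions on `ℝ^{p|q}`. -/
def modelRes {p : ℕ} (q : ℕ) {V W : Opens (EuclideanSpace ℝ (Fin p))} (h : W ≤ V) :
    Model q V →ₐ[ℝ] Model q W :=
  Algebra.TensorProduct.map (smoothRes h) (AlgHom.id ℝ (Grassmann q))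

/-- The `i`-th coordinate function. -/
def coordFun {p : ℕ} (V : Opens (EuclideanSpace ℝ (Fin p))) (i : Fin p) : Smooth V :=
  ⟨fun v => v.1 i, by
    have h : ContMDiff 𝓘(ℝ, EuclideanSpace ℝ (Fin p)) 𝓘(ℝ, ℝ) ∞
        (fun v : EuclideanSpace ℝ (Fin p) => v i) :=
      ContDiff.contMDiff (by fun_prop)
    exact h.comp contMDiff_subtype_val⟩

/-- A chart: an isomorphism of superspaces from an open part of `M` onto an open part of
`ℝ^{p|q}`. -/
structure Chart (M : SuperSpace.{u}) (p q : ℕ) where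
  homeo : OpenPartialHomeomorph M.carrier (EuclideanSpace ℝ (Fin p))
  iso : ∀ V : Opens (EuclideanSpace ℝ (Fin p)), (V : Set _) ⊆ homeo.target →
    Model q V ≃ₐ[ℝ] M.O ⟨homeo.source ∩ homeo ⁻¹' V, homeo.isOpen_inter_preimage V.2⟩
  iso_res : ∀ (V W : Opens (EuclideanSpace ℝ (Fin p))) (hV : (V : Set _) ⊆ homeo.target)
    (h : W ≤ V) (f : Model q V),
    SuperSpace.res (Set.inter_subset_inter_right _ (Set.preimage_mono h)) (iso V hV f) =
      iso W (subset_trans (SetLike.coe_subset_coe.2 h) hV) (modelRes q h f)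
  iso_parity : ∀ (V : Opens (EuclideanSpace ℝ (Fin p))) (hV : (V : Set _) ⊆ homeo.target)
    (i : ZMod 2) (f : Smooth V) (a : Grassmann q),
    a ∈ CliffordAlgebra.evenOdd (0 : QuadraticForm ℝ (Fin q → ℝ)) i →
      iso V hV (f ⊗ₜ a) ∈ M.parity _ i

namespace Chart

variable {M : SuperSpace.{u}} {p q : ℕ} (c : Chart M p q)

/-- The domain of a chart. -/
def domain : Opens M.carrier :=
  ⟨c.homeo.source ∩ c.homeo ⁻¹' (⟨c.homeo.target, c.homeo.open_target⟩ : Opens _),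
    c.homeo.isOpen_inter_preimage c.homeo.open_target⟩

/-- The coordinates of a chart: `p` even ones and `q` odd ones. -/
def coord : Fin p ⊕ Fin q → M.O c.domain
  | Sum.inl i => c.iso ⟨c.homeo.target, c.homeo.open_target⟩ subset_rfl (coordFun _ i ⊗ₜ 1)
  | Sum.inr j => c.iso ⟨c.homeo.target, c.homeo.open_target⟩ subset_rfl
      (1 ⊗ₜ ExteriorAlgebra.ι ℝ (Pi.single j 1))

end Chart

/-- A smooth supermanifold of dimension `p|q`. -/
structure Supermanifold (p q : ℕ) : Type (u + 1) extends SuperSpace.{u} where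
  t2 : T2Space carrier
  secondCountable : SecondCountableTopology carrier
  exists_chart : ∀ m : carrier, ∃ c : Chart toSuperSpace p q, m ∈ c.domain

/-- An even vector field is a weight vector field if around every point there are coordinates
`x i` with `N (x i) = w i x i` for real numbers `w i`. -/
def IsWeightVF {p q : ℕ} (M : Supermanifold.{u} p q) (N : M.HomVF ⊤ 0) : Prop :=
  ∀ m : M.carrier, ∃ (c : Chart M.toSuperSpace p q) (w : Fin p ⊕ Fin q → ℝ),
    m ∈ c.domain ∧ ∀ i, N.1 ⟨c.domain, le_top⟩ (c.coord i) = w i • c.coord i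

/-- Contact forms: non-degenerate one-forms such that `X ↦ i_X dα` has constant rank equal to the
total dimension minus one. -/
def IsContact {p q : ℕ} (M : Supermanifold.{u} p q) (α : M.OneForm) : Prop :=
  α.IsNondegenerate ∧ ∃ r : ℕ, α.DHasRank (p + q) r ∧ p + q = r + 1

end SuperGeom

end

noncomputable section

namespace SuperGeom

universe u

/-! Near a point, choose frames `X`, `Y` in which `dα` is diagonal with `r = p + q - 1` ones. The
tensoriality of `dα` (`dContr_smul_right`, `dContr_smul_left`) shows that the last frame field `X_r`
lies in `ker dα`, and that every field in `ker dα` is a multiple of `X_r`. A frame field vanishes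
nowhere, so non-degeneracy forces `α(X_r)` to be invertible near the point. Hence `α(X_r)⁻¹ X_r` is
a local Reeb field, and `ker α ∩ ker dα` contains no nonzero local field (`IsContact.exists_local`).
By this uniqueness the local Reeb fields agree on overlaps and glue (`VF.exists_glue`), and the
global field is unique.

Homogeneity also comes from uniqueness. If `α` has parity `σ`, the component of `R` of parity `σ`
again satisfies the Reeb equations, so it is `R`. If `L_N α = w α`, then `L_N dα = w dα`
(`dContr_bracket_even`), so `[N, R]` lies in `ker dα`; since `α([N, R]) = N(1) - w = -w`, it equals
`-w R`.

Finally, `R` vanishes nowhere because `α(R) = 1` is not a combination of functions non-invertible at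
a point (`Supermanifold.sum_mul_ne_one`). This needs an evaluation map to `ℝ` that detects local
invertibility; it exists because a superfunction differs from its body by a nilpotent. -/

theorem koszul_ne_zero (i j : ZMod 2) : koszul i j ≠ 0 := fun h => by
  simpa [h] using koszul_mul_self i j

namespace SuperSpace

variable {M : SuperSpace.{u}} {U V : Opens M.carrier}

/-! ### Superfunctions -/

theorem res_mem (h : V ≤ U) {i : ZMod 2} {f : M.O U} (hf : f ∈ M.parity U i) :
    res h f ∈ M.parity V i := M.map_parity h i f hf

theorem res_self (h : U ≤ U) (f : M.O U) : res h f = f := by simp [res]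

theorem part_of_mem {i : ZMod 2} {f : M.O U} (hf : f ∈ M.parity U i) (j : ZMod 2) :
    part j f = if j = i then f else 0 := by
  unfold part
  split_ifs with h
  · subst h; exact DirectSum.decompose_of_mem_same _ hf
  · exact DirectSum.decompose_of_mem_ne _ hf (Ne.symm h)

theorem sum_part (f : M.O U) : ∑ i : ZMod 2, part i f = f := by
  classical
  conv_rhs => rw [← DirectSum.sum_support_decompose (M.parity U) f]
  symm
  refine Finset.sum_subset (Finset.subset_univ _) fun i _ hi => ?_
  simpa using hi

theorem part_add (i : ZMod 2) (f g : M.O U) : part i (f + g) = part i f + part i g := by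
  simp [part, DirectSum.decompose_add]

theorem part_sum {ι : Type*} (s : Finset ι) (i : ZMod 2) (f : ι → M.O U) :
    part i (∑ k ∈ s, f k) = ∑ k ∈ s, part i (f k) :=
  map_sum (AddMonoidHom.mk' (fun f : M.O U => part i f) (part_add i)) f s

/-- The shifts `s + c` are distinct for distinct `s`, so the sum is a decomposition into parity
components. -/
theorem eq_zero_of_sum_mem_parity {F : ZMod 2 → M.O U} {c : ZMod 2}
    (hF : ∀ s, F s ∈ M.parity U (s + c)) (h : ∑ s, F s = 0) (s : ZMod 2) : F s = 0 := by
  have h1 : part (s + c) (∑ s, F s) = 0 := by rw [h]; simp [part]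
  rw [part_sum, Finset.sum_eq_single s] at h1
  · rwa [part_of_mem (hF s), if_pos rfl] at h1
  · intro t _ hts
    rw [part_of_mem (hF t), if_neg]
    exact fun h => hts (add_right_cancel h).symm
  · simp

theorem res_part (h : V ≤ U) (i : ZMod 2) (f : M.O U) : res h (part i f) = part i (res h f) := by
  conv_rhs => rw [← sum_part f, map_sum, part_sum]
  rw [Finset.sum_eq_single i]
  · rw [part_of_mem (res_mem h (part_mem i f)), if_pos rfl]
  · intro j _ hj
    rw [part_of_mem (res_mem h (part_mem j f)), if_neg hj.symm]
  · simp

theorem one_mem_parity : (1 : M.O U) ∈ M.parity U 0 := SetLike.GradedOne.one_mem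

theorem O.induction {P : M.O U → Prop} (f : M.O U) (hom : ∀ i, ∀ f ∈ M.parity U i, P f)
    (add : ∀ f g, P f → P g → P (f + g)) : P f := by
  rw [← sum_part f]
  have : (Finset.univ : Finset (ZMod 2)) = {0, 1} := rfl
  rw [this, Finset.sum_pair (by decide)]
  exact add _ _ (hom _ _ (part_mem _ _)) (hom _ _ (part_mem _ _))

/-! ### Vector fields -/

/-- The action of a homogeneous vector field on superfunctions on a smaller open set. -/
def app {s : ZMod 2} (D : M.HomVF U s) (h : V ≤ U) : M.O V →ₗ[ℝ] M.O V := D.1 ⟨V, h⟩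

theorem res_app {s : ZMod 2} (D : M.HomVF U s) {W : Opens M.carrier} (h : V ≤ U) (h' : W ≤ V)
    (f : M.O V) : res h' (app D h f) = app D (h'.trans h) (res h' f) :=
  D.2.1 ⟨V, h⟩ ⟨W, h'.trans h⟩ h' f

theorem app_mem {s : ZMod 2} (D : M.HomVF U s) (h : V ≤ U) {i : ZMod 2} {f : M.O V}
    (hf : f ∈ M.parity V i) : app D h f ∈ M.parity V (s + i) := D.2.2.1 ⟨V, h⟩ i f hf

theorem app_mul {s : ZMod 2} (D : M.HomVF U s) (h : V ≤ U) {i : ZMod 2} {f : M.O V}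
    (hf : f ∈ M.parity V i) (g : M.O V) :
    app D h (f * g) = app D h f * g + koszul s i • (f * app D h g) := D.2.2.2 ⟨V, h⟩ i f g hf

theorem app_one {s : ZMod 2} (D : M.HomVF U s) (h : V ≤ U) : app D h 1 = 0 := by
  have := app_mul D h one_mem_parity 1
  simpa [koszul] using this

theorem HomVF.ext_app {s : ZMod 2} {D E : M.HomVF U s}
    (h : ∀ (V : Opens M.carrier) (h : V ≤ U) (f : M.O V), app D h f = app E h f) : D = E :=
  Subtype.ext (funext fun V => LinearMap.ext (h V.1 V.2))

theorem VF.ext_app {X Y : M.VF U}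
    (h : ∀ (r : ZMod 2) (V : Opens M.carrier) (h : V ≤ U) (f : M.O V),
      app (X r) h f = app (Y r) h f) : X = Y :=
  funext fun r => HomVF.ext_app (h r)

theorem app_add {s : ZMod 2} (D E : M.HomVF U s) (h : V ≤ U) (f : M.O V) :
    app (D + E) h f = app D h f + app E h f := rfl

theorem app_smul {s : ZMod 2} (c : ℝ) (D : M.HomVF U s) (h : V ≤ U) (f : M.O V) :
    app (c • D) h f = c • app D h f := rfl

theorem app_sum {s : ZMod 2} {ι : Type*} (T : Finset ι) (D : ι → M.HomVF U s) (h : V ≤ U)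
    (g : M.O V) : app (∑ i ∈ T, D i) h g = ∑ i ∈ T, app (D i) h g := by
  induction T using Finset.cons_induction with
  | empty => rfl
  | cons a T ha ih =>
    rw [Finset.sum_cons, Finset.sum_cons, ← ih]; rfl

theorem VF.add_apply (X Y : M.VF U) (r : ZMod 2) : (X + Y) r = X r + Y r := rfl

theorem VF.smul_apply (c : ℝ) (X : M.VF U) (r : ZMod 2) : (c • X) r = c • X r := rfl

theorem app_ofHom {s : ZMod 2} (D : M.HomVF U s) (r : ZMod 2) (h : V ≤ U) (f : M.O V) :
    app (ofHom s D r) h f = if r = s then app D h f else 0 := by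
  unfold ofHom
  split_ifs with h
  · subst h; rw [Pi.single_eq_same]
  · rw [Pi.single_eq_of_ne h]; rfl

theorem act_eq_sum (X : M.VF U) (f : M.O U) : X.act f = ∑ s, app (X s) le_rfl f := rfl

theorem act_ofHom {s : ZMod 2} (D : M.HomVF U s) (f : M.O U) :
    (ofHom s D).act f = app D le_rfl f := by
  simp [act_eq_sum, app_ofHom]

theorem sum_ofHom (X : M.VF U) : ∑ s, ofHom s (X s) = X := Finset.univ_sum_single X

theorem ofHom_add {s : ZMod 2} (D E : M.HomVF U s) :
    ofHom s (D + E) = ofHom s D + ofHom s E :=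
  VF.ext_app fun r V h f => by
    simp only [VF.add_apply, app_add, app_ofHom]; split_ifs <;> simp

theorem ofHom_zero (s : ZMod 2) : ofHom s (0 : M.HomVF U s) = 0 := Pi.single_zero s

theorem VF.induction {P : M.VF U → Prop} (X : M.VF U) (hom : ∀ s D, P (ofHom s D))
    (add : ∀ X Y, P X → P Y → P (X + Y)) : P X := by
  rw [← sum_ofHom X]
  have : (Finset.univ : Finset (ZMod 2)) = {0, 1} := rfl
  rw [this, Finset.sum_pair (by decide)]
  exact add _ _ (hom _ _) (hom _ _)

theorem VFHasParity.eq_ofHom {X : M.VF U} {s : ZMod 2} (h : VFHasParity X s) :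
    X = ofHom s (X s) := by
  conv_lhs => rw [← sum_ofHom X]
  exact Finset.sum_eq_single s (fun t _ ht => by rw [h t ht, ofHom_zero]) (by simp)

/-- Restriction of homogeneous vector fields. -/
def resHom {s : ZMod 2} (h : V ≤ U) (D : M.HomVF U s) : M.HomVF V s :=
  ⟨fun W => D.1 ⟨W.1, W.2.trans h⟩,
    fun W W' => D.2.1 ⟨W.1, W.2.trans h⟩ ⟨W'.1, W'.2.trans h⟩,
    fun W => D.2.2.1 ⟨W.1, W.2.trans h⟩,
    fun W => D.2.2.2 ⟨W.1, W.2.trans h⟩⟩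

theorem app_resHom {W : Opens M.carrier} {s : ZMod 2} (h : V ≤ U) (h' : W ≤ V)
    (D : M.HomVF U s) (f : M.O W) : app (resHom h D) h' f = app D (h'.trans h) f := rfl

theorem resVF_apply (h : V ≤ U) (X : M.VF U) (s : ZMod 2) : resVF h X s = resHom h (X s) := rfl

theorem resVF_ofHom {s : ZMod 2} (h : V ≤ U) (D : M.HomVF U s) :
    resVF h (ofHom s D) = ofHom s (resHom h D) :=
  VF.ext_app fun r W h' f => by simp only [resVF_apply, app_resHom, app_ofHom]

theorem resVF_add (h : V ≤ U) (X Y : M.VF U) : resVF h (X + Y) = resVF h X + resVF h Y := rfl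

/-- Left multiplication of a homogeneous vector field by a homogeneous superfunction. -/
def smulHom {s t : ZMod 2} {f : M.O U} (hf : f ∈ M.parity U s) (D : M.HomVF U t) :
    M.HomVF U (s + t) := ⟨_, mul_mem_HomVF hf D⟩

theorem app_smulHom {s t : ZMod 2} {f : M.O U} (hf : f ∈ M.parity U s) (D : M.HomVF U t)
    (h : V ≤ U) (g : M.O V) : app (smulHom hf D) h g = res h f * app D h g := rfl

/-- The Lie superbracket of homogeneous vector fields. -/
def bracketHom {s t : ZMod 2} (D : M.HomVF U s) (E : M.HomVF U t) : M.HomVF U (s + t) :=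
  ⟨_, bracket_mem_HomVF D E⟩

theorem app_bracketHom {s t : ZMod 2} (D : M.HomVF U s) (E : M.HomVF U t)
    (h : V ≤ U) (g : M.O V) :
    app (bracketHom D E) h g = app D h (app E h g) - koszul s t • app E h (app D h g) := rfl

theorem app_smulVF (f : M.O U) (X : M.VF U) (r : ZMod 2) (h : V ≤ U) (g : M.O V) :
    app (smulVF f X r) h g = ∑ s, res h (part s f) * app (X (r - s)) h g := by
  unfold smulVF; rw [app_sum]; rfl

theorem app_bracket (X Y : M.VF U) (r : ZMod 2) (h : V ≤ U) (g : M.O V) :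
    app (bracket X Y r) h g = ∑ s, (app (X s) h (app (Y (r - s)) h g)
      - koszul s (r - s) • app (Y (r - s)) h (app (X s) h g)) := by
  unfold bracket; rw [app_sum]; rfl

/-- The sum over parities collapses to one term. With `bracket_ofHom` and the two induction
principles, this reduces identities to homogeneous arguments. -/
theorem smulVF_ofHom {s t : ZMod 2} {f : M.O U} (hf : f ∈ M.parity U s) (D : M.HomVF U t) :
    smulVF f (ofHom t D) = ofHom (s + t) (smulHom hf D) := by
  refine VF.ext_app fun r V h g => ?_
  rw [app_smulVF, Finset.sum_eq_single s]
  · rw [part_of_mem hf, if_pos rfl, app_ofHom, app_ofHom, app_smulHom]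
    simp only [sub_eq_iff_eq_add, add_comm t s]
    split_ifs <;> simp
  · intro i _ hi
    rw [part_of_mem hf, if_neg hi]; simp
  · simp

theorem bracket_ofHom {s t : ZMod 2} (D : M.HomVF U s) (E : M.HomVF U t) :
    bracket (ofHom s D) (ofHom t E) = ofHom (s + t) (bracketHom D E) := by
  refine VF.ext_app fun r V h g => ?_
  rw [app_bracket, Finset.sum_eq_single s]
  · by_cases hr : r = s + t
    · subst hr
      simp [app_ofHom, app_bracketHom]
    · have : r - s ≠ t := fun h => hr (by rw [← h]; abel)
      simp [app_ofHom, hr, this]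
  · intro i _ hi
    simp [app_ofHom, hi]
  · simp

theorem smulVF_add (f : M.O U) (X Y : M.VF U) :
    smulVF f (X + Y) = smulVF f X + smulVF f Y := by
  refine VF.ext_app fun r V h g => ?_
  simp only [VF.add_apply, app_add, app_smulVF, mul_add, Finset.sum_add_distrib]

theorem add_smulVF (f g : M.O U) (X : M.VF U) :
    smulVF (f + g) X = smulVF f X + smulVF g X := by
  refine VF.ext_app fun r V h k => ?_
  simp only [VF.add_apply, app_add, app_smulVF, part_add, map_add, add_mul,
    Finset.sum_add_distrib]

theorem zero_smulVF (X : M.VF U) : smulVF 0 X = 0 :=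
  (AddMonoidHom.mk' (fun f => smulVF f X) fun f g => add_smulVF f g X).map_zero

theorem sum_smulVF {ι : Type*} (T : Finset ι) (f : ι → M.O U) (X : M.VF U) :
    smulVF (∑ i ∈ T, f i) X = ∑ i ∈ T, smulVF (f i) X :=
  map_sum (AddMonoidHom.mk' (fun f => smulVF f X) fun f g => add_smulVF f g X) f T

theorem smulVF_sum {ι : Type*} (T : Finset ι) (f : M.O U) (X : ι → M.VF U) :
    smulVF f (∑ i ∈ T, X i) = ∑ i ∈ T, smulVF f (X i) :=
  map_sum (AddMonoidHom.mk' (fun X => smulVF f X) fun X Y => smulVF_add f X Y) X T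

theorem one_smulVF (X : M.VF U) : smulVF 1 X = X := by
  refine VF.ext_app fun r V h g => ?_
  rw [app_smulVF, Finset.sum_eq_single 0]
  · rw [part_of_mem one_mem_parity, if_pos rfl, sub_zero]; simp
  · intro i _ hi
    rw [part_of_mem one_mem_parity, if_neg hi]; simp
  · simp

theorem algebraMap_smulVF (c : ℝ) (X : M.VF U) : smulVF (algebraMap ℝ _ c) X = c • X := by
  have hc : algebraMap ℝ (M.O U) c ∈ M.parity U 0 := by
    rw [Algebra.algebraMap_eq_smul_one]
    exact Submodule.smul_mem _ _ one_mem_parity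
  refine VF.ext_app fun r V h g => ?_
  rw [app_smulVF, Finset.sum_eq_single 0]
  · rw [part_of_mem hc, if_pos rfl, sub_zero, AlgHom.commutes, VF.smul_apply, app_smul,
      Algebra.smul_def]
  · intro i _ hi
    rw [part_of_mem hc, if_neg hi]; simp
  · simp

/-- Writing the difference as a sum with a real multiple means that closure of `ker dα` under
`MemKerD.add` and `MemKerD.smul` suffices for the uniqueness arguments. -/
theorem VF.eq_of_add_neg_smul {X Y : M.VF U} (h : X + (-1 : ℝ) • Y = 0) : X = Y := by
  refine VF.ext_app fun r V hV g => ?_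
  have h1 : app (X r) hV g + (-1 : ℝ) • app (Y r) hV g = 0 :=
    congrArg (fun Z : M.VF U => app (Z r) hV g) h
  rwa [neg_one_smul, ← sub_eq_add_neg, sub_eq_zero] at h1

theorem mul_smulVF (f g : M.O U) (X : M.VF U) : smulVF (f * g) X = smulVF f (smulVF g X) := by
  induction f using O.induction with
  | add f f' hf hf' => rw [add_mul, add_smulVF, add_smulVF, hf, hf']
  | hom i f hf =>
  induction g using O.induction with
  | add g g' hg hg' => rw [mul_add, add_smulVF, add_smulVF, smulVF_add, hg, hg']
  | hom j g hg =>
  induction X using VF.induction with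
  | add X Y hX hY => simp only [smulVF_add, hX, hY]
  | hom s D =>
  rw [smulVF_ofHom (SetLike.mul_mem_graded hf hg), smulVF_ofHom hg, smulVF_ofHom hf]
  refine VF.ext_app fun r V h k => ?_
  simp only [app_ofHom, app_smulHom, map_mul, mul_assoc, add_assoc]

theorem resVF_smulVF (h : V ≤ U) (f : M.O U) (X : M.VF U) :
    resVF h (smulVF f X) = smulVF (res h f) (resVF h X) := by
  refine VF.ext_app fun r W h' g => ?_
  simp only [resVF_apply, app_resHom, app_smulVF, ← res_part, res_res]

theorem resVF_bracket (h : V ≤ U) (X Y : M.VF U) :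
    resVF h (bracket X Y) = bracket (resVF h X) (resVF h Y) := by
  refine VF.ext_app fun r W h' g => ?_
  simp only [resVF_apply, app_resHom, app_bracket]

theorem bracket_add (X Y Z : M.VF U) : bracket X (Y + Z) = bracket X Y + bracket X Z := by
  refine VF.ext_app fun r V h g => ?_
  simp only [VF.add_apply, app_add, app_bracket, map_add, smul_add, ← Finset.sum_add_distrib]
  refine Finset.sum_congr rfl fun s _ => ?_
  abel

/-- The super Jacobi identity has no signs when one entry is even. The unsimplified degrees are
those produced by `bracketHom`, which avoids transport along equalities of parities. -/
theorem jacobi_even {s t : ZMod 2} (N : M.HomVF U 0) (D : M.HomVF U s) (E : M.HomVF U t) :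
    ofHom (0 + s + t) (bracketHom (bracketHom N D) E) +
      ofHom (s + (0 + t)) (bracketHom D (bracketHom N E)) =
    bracket (ofHom 0 N) (ofHom (s + t) (bracketHom D E)) := by
  rw [bracket_ofHom]
  refine VF.ext_app fun r V h g => ?_
  have hk (i : ZMod 2) : koszul 0 i = 1 := by simp [koszul]
  simp only [VF.add_apply, app_add, app_ofHom, app_bracketHom, zero_add, hk, one_smul, map_sub,
    map_smul, smul_sub]
  split_ifs
  · abel
  · simp

/-! ### Contractions of one-forms -/

namespace OneForm

variable (α : M.OneForm)

/-- The double contraction `i_E i_D dα` for homogeneous vector fields. -/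
def dContrHom {s t : ZMod 2} (D : M.HomVF U s) (E : M.HomVF U t) : M.O U :=
  koszul s t • app D le_rfl (α.contr (ofHom t E)) - app E le_rfl (α.contr (ofHom s D))
    - koszul s t • α.contr (ofHom (s + t) (bracketHom D E))

theorem dContr_eq_sum (X Y : M.VF U) :
    α.dContr X Y = ∑ s, ∑ t, α.dContrHom (X s) (Y t) := by
  simp only [dContr, act_ofHom, bracket_ofHom, dContrHom]

theorem dContrHom_add_left {s t : ZMod 2} (D D' : M.HomVF U s) (E : M.HomVF U t) :
    α.dContrHom (D + D') E = α.dContrHom D E + α.dContrHom D' E := by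
  have h : bracketHom (D + D') E = bracketHom D E + bracketHom D' E := by
    refine HomVF.ext_app fun V h g => ?_
    simp only [app_add, app_bracketHom, map_add, smul_add]; abel
  simp only [dContrHom, h, app_add, ofHom_add, map_add, smul_add]
  abel

theorem dContrHom_add_right {s t : ZMod 2} (D : M.HomVF U s) (E E' : M.HomVF U t) :
    α.dContrHom D (E + E') = α.dContrHom D E + α.dContrHom D E' := by
  have h : bracketHom D (E + E') = bracketHom D E + bracketHom D E' := by
    refine HomVF.ext_app fun V h g => ?_
    simp only [app_add, app_bracketHom, map_add, smul_add]; abel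
  simp only [dContrHom, h, app_add, ofHom_add, map_add, smul_add]
  abel

theorem dContr_add_left (X X' Y : M.VF U) :
    α.dContr (X + X') Y = α.dContr X Y + α.dContr X' Y := by
  simp only [dContr_eq_sum, VF.add_apply, dContrHom_add_left, Finset.sum_add_distrib]

theorem dContr_add_right (X Y Y' : M.VF U) :
    α.dContr X (Y + Y') = α.dContr X Y + α.dContr X Y' := by
  simp only [dContr_eq_sum, VF.add_apply, dContrHom_add_right, Finset.sum_add_distrib]

theorem dContr_sum_left {ι : Type*} (T : Finset ι) (X : ι → M.VF U) (Y : M.VF U) :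
    α.dContr (∑ i ∈ T, X i) Y = ∑ i ∈ T, α.dContr (X i) Y :=
  map_sum (AddMonoidHom.mk' (fun X => α.dContr X Y) fun X X' => α.dContr_add_left X X' Y) X T

theorem dContr_sum_right {ι : Type*} (T : Finset ι) (X : M.VF U) (Y : ι → M.VF U) :
    α.dContr X (∑ i ∈ T, Y i) = ∑ i ∈ T, α.dContr X (Y i) :=
  map_sum (AddMonoidHom.mk' (fun Y => α.dContr X Y) fun Y Y' => α.dContr_add_right X Y Y') Y T

theorem dContrHom_zero_left {s t : ZMod 2} (E : M.HomVF U t) :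
    α.dContrHom (0 : M.HomVF U s) E = 0 :=
  (AddMonoidHom.mk' (fun D : M.HomVF U s => α.dContrHom D E)
    fun D D' => α.dContrHom_add_left D D' E).map_zero

theorem dContrHom_zero_right {s t : ZMod 2} (D : M.HomVF U s) :
    α.dContrHom D (0 : M.HomVF U t) = 0 :=
  (AddMonoidHom.mk' (fun E : M.HomVF U t => α.dContrHom D E)
    fun E E' => α.dContrHom_add_right D E E').map_zero

theorem dContr_ofHom_ofHom {s t : ZMod 2} (D : M.HomVF U s) (E : M.HomVF U t) :
    α.dContr (ofHom s D) (ofHom t E) = α.dContrHom D E := by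
  rw [dContr_eq_sum, Finset.sum_eq_single s, Finset.sum_eq_single t]
  · simp only [ofHom, Pi.single_eq_same]
  · intro b _ hb
    rw [ofHom, ofHom, Pi.single_eq_of_ne hb, dContrHom_zero_right]
  · simp
  · intro b _ hb
    refine Finset.sum_eq_zero fun t' _ => ?_
    rw [ofHom, Pi.single_eq_of_ne hb, dContrHom_zero_left]
  · simp

theorem dContr_res (h : V ≤ U) (X Y : M.VF U) :
    α.dContr (resVF h X) (resVF h Y) = res h (α.dContr X Y) := by
  simp only [dContr_eq_sum, map_sum]
  refine Finset.sum_congr rfl fun s _ => Finset.sum_congr rfl fun t _ => ?_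
  simp only [dContrHom, map_sub, map_smul, res_app, ← α.contr_res, resVF_ofHom]
  rfl

/-- The term `D(f) α(E)` from differentiating `α(fE)` cancels against the same term from `α([D,
fE])`. -/
theorem dContr_smul_right (f : M.O U) (X Y : M.VF U) :
    α.dContr X (smulVF f Y) = f * α.dContr X Y := by
  induction f using O.induction with
  | add f f' hf hf' => rw [add_mul, add_smulVF, dContr_add_right, hf, hf']
  | hom a f hf =>
  induction X using VF.induction with
  | add X X' hX hX' => simp only [dContr_add_left, mul_add, hX, hX']
  | hom s D =>
  induction Y using VF.induction with
  | add Y Y' hY hY' => simp only [smulVF_add, dContr_add_right, mul_add, hY, hY']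
  | hom t E =>
  -- Leibniz rule: `[D, fE] = D(f) E + (-1)^(s a) f [D, E]`.
  have hb : ofHom (s + (a + t)) (bracketHom D (smulHom hf E)) =
      smulVF (app D le_rfl f) (ofHom t E) +
        koszul s a • smulVF f (ofHom (s + t) (bracketHom D E)) := by
    rw [smulVF_ofHom (app_mem D le_rfl hf), smulVF_ofHom hf]
    refine VF.ext_app fun r V h g => ?_
    have e1 : s + a + t = s + (a + t) := add_assoc _ _ _
    have e2 : a + (s + t) = s + (a + t) := add_left_comm _ _ _
    simp only [VF.add_apply, VF.smul_apply, app_add, app_smul, app_ofHom, e1, e2, app_bracketHom,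
      app_smulHom]
    split_ifs with hr
    · rw [app_mul D h (res_mem h hf), res_app, koszul_add_right, mul_sub, smul_sub,
        mul_smul_comm, smul_smul, add_sub_assoc]
    · simp
  rw [smulVF_ofHom hf, dContr_ofHom_ofHom, dContr_ofHom_ofHom]
  unfold dContrHom
  rw [hb, ← smulVF_ofHom hf, map_add, map_smul, contr_smul, contr_smul, contr_smul,
    app_mul D le_rfl hf, app_smulHom, koszul_add_right, res_self]
  simp only [smul_add, smul_smul, mul_sub, mul_smul_comm]
  rw [show koszul s a * koszul s t * koszul s a = koszul s t by
    rw [mul_comm, ← mul_assoc, koszul_mul_self, one_mul]]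
  abel

/-- The sign arises from moving `f` past `E`; it depends on both parities, so `f` and the second
argument must be homogeneous. -/
theorem dContr_smul_left {a t : ZMod 2} {f : M.O U} (hf : f ∈ M.parity U a) (X : M.VF U)
    (E : M.HomVF U t) :
    α.dContr (smulVF f X) (ofHom t E) = koszul a t • (f * α.dContr X (ofHom t E)) := by
  induction X using VF.induction with
  | add X X' hX hX' => simp only [smulVF_add, dContr_add_left, mul_add, smul_add, hX, hX']
  | hom s D =>
  -- Leibniz rule on the left: `[fD, E] = f [D, E] - (-1)^((a + s) t) E(f) D`.
  have hb : ofHom (a + s + t) (bracketHom (smulHom hf D) E) =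
      smulVF f (ofHom (s + t) (bracketHom D E)) +
        (-koszul (a + s) t) • smulVF (app E le_rfl f) (ofHom s D) := by
    rw [smulVF_ofHom (app_mem E le_rfl hf), smulVF_ofHom hf]
    refine VF.ext_app fun r V h g => ?_
    have e1 : a + s + t = a + (s + t) := add_assoc _ _ _
    have e2 : t + a + s = a + (s + t) := by abel
    simp only [VF.add_apply, VF.smul_apply, app_add, app_smul, app_ofHom, e1, e2, app_bracketHom,
      app_smulHom]
    split_ifs with hr
    · rw [app_mul E h (res_mem h hf), res_app, koszul_add_left, mul_sub, smul_add, smul_smul,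
        mul_smul_comm, show koszul a t * koszul s t * koszul t a = koszul s t by
          rw [koszul_comm t a, mul_comm, ← mul_assoc, koszul_mul_self, one_mul], neg_smul]
      abel
    · simp
  rw [smulVF_ofHom hf, dContr_ofHom_ofHom, dContr_ofHom_ofHom]
  unfold dContrHom
  rw [hb, ← smulVF_ofHom hf, map_add, map_smul, contr_smul, contr_smul, contr_smul,
    app_mul E le_rfl hf, app_smulHom, koszul_add_left, res_self, koszul_comm t a]
  simp only [smul_add, smul_sub, smul_smul, mul_sub, mul_smul_comm, smul_neg, neg_smul]
  rw [show koszul a t * koszul s t * (koszul a t * koszul s t) = 1 by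
    rw [mul_mul_mul_comm, koszul_mul_self, koszul_mul_self, one_mul], one_smul]
  abel

/-! ### The kernel of `dα` as a module over superfunctions -/

variable {α}

/-- The contraction is `f` with its parity components multiplied by signs, so each component
vanishes separately. -/
theorem eq_zero_of_dContr_smul_eq_zero {t : ZMod 2} {f : M.O U} {X Y : M.VF U}
    (hY : VFHasParity Y t) (hXY : α.dContr X Y = 1) (h : α.dContr (smulVF f X) Y = 0) : f = 0 := by
  rw [hY.eq_ofHom] at h hXY
  have h1 : ∑ a, koszul a t • part a f = 0 := by
    rw [← h]
    conv_rhs => rw [← sum_part f, sum_smulVF, dContr_sum_left]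
    refine Finset.sum_congr rfl fun a _ => ?_
    rw [dContr_smul_left α (part_mem a f), hXY, mul_one]
  have h2 := eq_zero_of_sum_mem_parity (c := 0) (F := fun a => koszul a t • part a f)
    (fun a => by rw [add_zero]; exact Submodule.smul_mem _ _ (part_mem a f)) h1
  rw [← sum_part f]
  exact Finset.sum_eq_zero fun a _ => (smul_eq_zero.1 (h2 a)).resolve_left (koszul_ne_zero a t)

theorem MemKerD.res {X : M.VF U} (hX : α.MemKerD X) (h : V ≤ U) : α.MemKerD (resVF h X) :=
  fun W h' Y => hX W (h'.trans h) Y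

theorem MemKerD.add {X Y : M.VF U} (hX : α.MemKerD X) (hY : α.MemKerD Y) :
    α.MemKerD (X + Y) := fun W h Z => by
  rw [resVF_add, dContr_add_left, hX W h, hY W h, add_zero]

theorem MemKerD.smulVF {X : M.VF U} (hX : α.MemKerD X) (f : M.O U) :
    α.MemKerD (smulVF f X) := fun W h Z => by
  rw [resVF_smulVF]
  induction Z using VF.induction with
  | add Z Z' h1 h2 => rw [dContr_add_right, h1, h2, add_zero]
  | hom t E =>
  rw [← sum_part (SuperSpace.res h f), sum_smulVF, dContr_sum_left]
  refine Finset.sum_eq_zero fun a _ => ?_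
  rw [dContr_smul_left α (part_mem _ _), hX W h, mul_zero, smul_zero]

theorem MemKerD.smul {X : M.VF U} (hX : α.MemKerD X) (c : ℝ) : α.MemKerD (c • X) := by
  rw [← algebraMap_smulVF]
  exact hX.smulVF _

/-! ### Parity -/

theorem HasParity.dContrHom_mem {σ : ZMod 2} (hσ : α.HasParity σ) {s t : ZMod 2}
    (D : M.HomVF U s) (E : M.HomVF U t) : α.dContrHom D E ∈ M.parity U (s + (t + σ)) := by
  refine sub_mem (sub_mem (Submodule.smul_mem _ _ ?_) ?_) (Submodule.smul_mem _ _ ?_)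
  · exact app_mem D _ (hσ U t E)
  · rw [add_left_comm]
    exact app_mem E _ (hσ U s D)
  · rw [← add_assoc]
    exact hσ U _ _

/-- For homogeneous `α`, the components of `X` contract with a homogeneous field to functions of
different parities, which cannot cancel each other. -/
theorem MemKerD.ofHom {σ : ZMod 2} (hσ : α.HasParity σ) {X : M.VF U} (hX : α.MemKerD X)
    (s : ZMod 2) : α.MemKerD (ofHom s (X s)) := fun V h Y => by
  rw [resVF_ofHom]
  induction Y using VF.induction with
  | add Z Z' h1 h2 => rw [dContr_add_right, h1, h2, add_zero]
  | hom t E =>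
  rw [dContr_ofHom_ofHom]
  refine eq_zero_of_sum_mem_parity (c := t + σ)
    (F := fun s => α.dContrHom (resHom h (X s)) E) (fun s => hσ.dContrHom_mem _ E) ?_ s
  rw [← hX V h (SuperSpace.ofHom t E), ← sum_ofHom (resVF h X), dContr_sum_left]
  simp only [dContr_ofHom_ofHom, resVF_apply]

/-- The function `1` is even, and `s + σ = 0` in `ZMod 2` only for `s = σ`; the other component does
not contribute. -/
theorem HasParity.contr_ofHom {σ : ZMod 2} (hσ : α.HasParity σ) {X : M.VF U}
    (hX : α.contr X = 1) : α.contr (SuperSpace.ofHom σ (X σ)) = 1 := by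
  have h0 : σ + σ = 0 := CharTwo.add_self_eq_zero σ
  have h1 : part 0 (∑ s, α.contr (SuperSpace.ofHom s (X s))) = 1 := by
    rw [← map_sum, sum_ofHom, hX, part_of_mem one_mem_parity, if_pos rfl]
  rw [part_sum, Finset.sum_eq_single σ] at h1
  · rwa [part_of_mem (hσ U σ (X σ)), if_pos h0.symm] at h1
  · intro s _ hs
    rw [part_of_mem (hσ U s (X s)), if_neg]
    exact fun h => hs (add_right_cancel (h.symm.trans h0.symm))
  · simp

/-! ### Weight -/

/-- This is `L_N dα = w dα`, contracted with `X` and `Y`: it makes `ker dα` stable under `[N, ·]`.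
-/
theorem dContr_bracket_even {w : ℝ} (N : M.HomVF U 0)
    (hw : ∀ X : M.VF U, α.contr (bracket (ofHom 0 N) X) =
      app N le_rfl (α.contr X) - w • α.contr X) (X Y : M.VF U) :
    α.dContr (bracket (ofHom 0 N) X) Y + α.dContr X (bracket (ofHom 0 N) Y) =
      app N le_rfl (α.dContr X Y) - w • α.dContr X Y := by
  induction X using VF.induction with
  | add X X' hX hX' =>
    simp only [bracket_add, dContr_add_left, map_add, smul_add]
    rw [add_add_add_comm, hX, hX']; abel
  | hom s D =>
  induction Y using VF.induction with
  | add Y Y' hY hY' =>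
    simp only [bracket_add, dContr_add_right, map_add, smul_add]
    rw [add_add_add_comm, hY, hY']; abel
  | hom t E =>
  have hD := hw (ofHom s D)
  have hE := hw (ofHom t E)
  have hDE := hw (ofHom (s + t) (bracketHom D E))
  rw [← jacobi_even, map_add] at hDE
  rw [bracket_ofHom] at hD hE ⊢
  rw [bracket_ofHom, dContr_ofHom_ofHom, dContr_ofHom_ofHom, dContr_ofHom_ofHom]
  have hk (i : ZMod 2) : koszul 0 i = 1 := by simp [koszul]
  -- The bracket term of `dContrHom` carries the sign `koszul s t`, so the weight identity for `[D,
  -- E]` is multiplied by it.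
  have hDE' := congrArg (koszul s t • ·) hDE
  simp only [smul_add, smul_sub] at hDE'
  unfold dContrHom
  rw [hD, hE]
  have e1 : koszul (0 + s) t = koszul s t := by rw [zero_add]
  have e2 : koszul s (0 + t) = koszul s t := by rw [zero_add]
  rw [e1, e2, ← sub_eq_zero]
  rw [← sub_eq_zero] at hDE'
  -- The claim is the negative of `hDE'` once the actions of `[N, D]` and `[N, E]` on functions are
  -- expanded into commutators.
  rw [← neg_eq_zero, ← hDE']
  simp only [app_bracketHom, hk, one_smul, map_sub, map_smul, smul_sub, smul_comm w (koszul s t)]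
  abel

theorem HasWeight.contr_bracket {N : M.HomVF ⊤ 0} {w : ℝ} (hw : α.HasWeight N w) (X : M.VF U) :
    α.contr (bracket (SuperSpace.ofHom 0 (resHom le_top N)) X) =
      app (resHom le_top N) (le_refl U) (α.contr X) - w • α.contr X := by
  have h := hw U X
  rw [lieContr, resVF_ofHom, act_ofHom] at h
  rw [← h, sub_sub_cancel]

theorem MemKerD.bracket {N : M.HomVF ⊤ 0} {w : ℝ} (hw : α.HasWeight N w) {X : M.VF ⊤}
    (hX : α.MemKerD X) : α.MemKerD (bracket (SuperSpace.ofHom 0 N) X) := fun V h Y => by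
  have h1 := dContr_bracket_even (resHom h N) (fun X => hw.contr_bracket X) (resVF h X) Y
  rwa [hX V h, hX V h, add_zero, map_zero, smul_zero, sub_zero, ← resVF_ofHom,
    ← resVF_bracket] at h1

end OneForm

/-! ### Gluing -/

section Gluing

variable {ι : Type*} {C : ι → Opens M.carrier}

/-- A vector field acts on functions over every open set `V`, so a single cover of the whole space
is used and intersected with each `V`. -/
theorem O.eq_of_cover (hC : ∀ m, ∃ i, m ∈ C i) {f g : M.O V}
    (h : ∀ i, res (inf_le_left : V ⊓ C i ≤ V) f = res inf_le_left g) : f = g := by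
  refine M.sheaf.eq_of_locally_eq' (fun i => V ⊓ C i) V (fun i => homOfLE inf_le_left) ?_ f g h
  intro m hm
  obtain ⟨i, hi⟩ := hC m
  exact Opens.mem_iSup.2 ⟨i, hm, hi⟩

theorem O.exists_glue (hC : ∀ m, ∃ i, m ∈ C i) (f : ∀ i, M.O (V ⊓ C i))
    (h : ∀ (i j : ι) (W : Opens M.carrier) (hi : W ≤ V ⊓ C i) (hj : W ≤ V ⊓ C j),
      res hi (f i) = res hj (f j)) :
    ∃ g : M.O V, ∀ i, res inf_le_left g = f i := by
  refine (M.sheaf.existsUnique_gluing' (fun i => V ⊓ C i) V (fun i => homOfLE inf_le_left) ?_ f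
    fun i j => h i j _ inf_le_left inf_le_right).exists
  intro m hm
  obtain ⟨i, hi⟩ := hC m
  exact Opens.mem_iSup.2 ⟨i, hm, hi⟩

theorem VF.eq_zero_of_cover (hC : ∀ m, ∃ i, m ∈ C i) {X : M.VF ⊤}
    (h : ∀ i, resVF (le_top : C i ≤ ⊤) X = 0) : X = 0 := by
  refine VF.ext_app fun r V hV f => O.eq_of_cover hC fun i => ?_
  rw [res_app]
  have := congrArg (fun Z : M.VF (C i) =>
    app (Z r) (inf_le_right : V ⊓ C i ≤ C i) (res inf_le_left f)) (h i)
  refine this.trans ?_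
  exact (map_zero (res (inf_le_left : V ⊓ C i ≤ V))).symm

/-- The value on `f` is glued from the values of `D i` on the restrictions of `f`. Linearity, parity
and the Leibniz rule are then checked on the cover. -/
theorem HomVF.exists_glue (hC : ∀ m, ∃ i, m ∈ C i) {s : ZMod 2} (D : ∀ i, M.HomVF (C i) s)
    (h : ∀ (i j : ι) (W : Opens M.carrier) (hi : W ≤ C i) (hj : W ≤ C j) (f : M.O W),
      app (D i) hi f = app (D j) hj f) :
    ∃ E : M.HomVF ⊤ s, ∀ i, resHom le_top E = D i := by
  have hex (V : Opens M.carrier) (f : M.O V) : ∃ g : M.O V, ∀ i, res inf_le_left g =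
      app (D i) inf_le_right (res (inf_le_left : V ⊓ C i ≤ V) f) := by
    refine O.exists_glue hC _ fun i j W hi hj => ?_
    rw [res_app, res_app, res_res, res_res]
    exact h i j W _ _ _
  choose G hG using hex
  have hres (V W : Opens M.carrier) (hWV : W ≤ V) (f : M.O V) :
      res hWV (G V f) = G W (res hWV f) := by
    refine O.eq_of_cover hC fun i => ?_
    have h1 := congrArg (res (inf_le_inf_right (C i) hWV)) (hG V f i)
    rw [res_res, res_app, res_res] at h1
    rw [hG, res_res, res_res, h1]
  let L (V : Opens M.carrier) : M.O V →ₗ[ℝ] M.O V :=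
    { toFun := G V
      map_add' := fun f g => O.eq_of_cover hC fun i => by
        rw [map_add, hG, hG, hG, map_add, map_add]
      map_smul' := fun c f => O.eq_of_cover hC fun i => by
        rw [RingHom.id_apply, map_smul, hG, hG, map_smul, map_smul] }
  refine ⟨⟨fun V => L V.1, fun V W hWV f => hres V.1 W.1 hWV f, fun V i f hf => ?_,
    fun V i f g hf => ?_⟩, fun i => ?_⟩
  -- Being of parity `s + i` is expressed as an equality of sections, which can be tested locally.
  · have : part (s + i) (G V.1 f) = G V.1 f := by
      refine O.eq_of_cover hC fun j => ?_
      rw [res_part, hG, part_of_mem (app_mem (D j) _ (res_mem _ hf)), if_pos rfl]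
    rw [show L V.1 f = G V.1 f from rfl, ← this]
    exact part_mem _ _
  · refine O.eq_of_cover hC fun j => ?_
    change res _ (G V.1 (f * g)) = res _ (G V.1 f * g + koszul s i • (f * G V.1 g))
    rw [hG, map_mul, app_mul (D j) _ (res_mem _ hf), map_add, map_mul, map_smul, map_mul, hG, hG]
  · refine HomVF.ext_app fun W hW f => O.eq_of_cover hC fun j => ?_
    change res _ (G W f) = _
    rw [hG, res_app]
    exact h j i _ _ _ _

theorem VF.exists_glue (hC : ∀ m, ∃ i, m ∈ C i) (X : ∀ i, M.VF (C i))
    (h : ∀ i j, resVF (inf_le_left : C i ⊓ C j ≤ C i) (X i) = resVF inf_le_right (X j)) :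
    ∃ Y : M.VF ⊤, ∀ i, resVF le_top Y = X i := by
  have h1 (s : ZMod 2) : ∃ E : M.HomVF ⊤ s, ∀ i, resHom le_top E = X i s := by
    refine HomVF.exists_glue hC (fun i => X i s) fun i j W hi hj f => ?_
    exact congrArg (fun Z : M.VF (C i ⊓ C j) => app (Z s) (le_inf hi hj) f) (h i j)
  choose E hE using h1
  exact ⟨E, fun i => funext fun s => hE s i⟩

end Gluing

end SuperSpace
/-! ### The local rings of the model -/

section Grassmann

variable (q : ℕ)

/-- The augmentation ideal of the exterior algebra. -/
def augIdeal : Submodule ℝ (Grassmann q) := LinearMap.range (ExteriorAlgebra.ι ℝ) * ⊤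

variable {q}

/-- For products, `ab - ε(a)ε(b) = (a - ε(a)) b + ε(a) (b - ε(b))`, where `ε` is the scalar part. -/
theorem sub_algebraMapInv_mem (a : Grassmann q) :
    a - algebraMap ℝ _ (ExteriorAlgebra.algebraMapInv a) ∈ augIdeal q := by
  have hr : ∀ x ∈ augIdeal q, ∀ b, x * b ∈ augIdeal q := fun x hx b => by
    have h := Submodule.mul_mem_mul hx (Submodule.mem_top (x := b))
    rw [augIdeal, mul_assoc] at h
    exact SetLike.le_def.1 (mul_le_mul' le_rfl le_top) h
  induction a using ExteriorAlgebra.induction with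
  | algebraMap r => simp [ExteriorAlgebra.algebraMapInv]
  | ι v =>
    have h := Submodule.mul_mem_mul (LinearMap.mem_range_self (ExteriorAlgebra.ι ℝ) v)
      (Submodule.mem_top (x := (1 : Grassmann q)))
    simpa [ExteriorAlgebra.algebraMapInv, augIdeal] using h
  | mul a b ha hb =>
    have h := add_mem (hr _ ha b)
      (Submodule.smul_mem _ (ExteriorAlgebra.algebraMapInv a) hb)
    convert h using 1
    rw [map_mul, map_mul, Algebra.smul_def]
    noncomm_ring
  | add a b ha hb =>
    have h := add_mem ha hb
    rwa [map_add, map_add, add_sub_add_comm]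

theorem top_mul_range_ι_le :
    (⊤ : Submodule ℝ (Grassmann q)) * LinearMap.range (ExteriorAlgebra.ι ℝ) ≤ augIdeal q := by
  rw [Submodule.mul_le]
  rintro a - _ ⟨v, rfl⟩
  have h := sub_algebraMapInv_mem (a * ExteriorAlgebra.ι ℝ v)
  simpa [ExteriorAlgebra.algebraMapInv] using h

/-- Since `⊤ * range ι ≤ range ι * ⊤`, all generator factors can be moved to the left. -/
theorem augIdeal_pow_le (n : ℕ) :
    augIdeal q ^ n ≤ LinearMap.range (ExteriorAlgebra.ι ℝ) ^ n * ⊤ := by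
  induction n with
  | zero => simp
  | succ n ih =>
    have h : (⊤ : Submodule ℝ (Grassmann q)) * ⊤ ≤ ⊤ := le_top
    calc augIdeal q ^ (n + 1) = augIdeal q ^ n * augIdeal q := pow_succ _ _
      _ ≤ LinearMap.range (ExteriorAlgebra.ι ℝ) ^ n * ⊤ * augIdeal q :=
        mul_le_mul' ih le_rfl
      _ = LinearMap.range (ExteriorAlgebra.ι ℝ) ^ n *
          (⊤ * LinearMap.range (ExteriorAlgebra.ι ℝ)) * ⊤ := by
        simp only [augIdeal, mul_assoc]
      _ ≤ LinearMap.range (ExteriorAlgebra.ι ℝ) ^ n * augIdeal q * ⊤ :=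
        mul_le_mul' (mul_le_mul' le_rfl top_mul_range_ι_le) le_rfl
      _ = LinearMap.range (ExteriorAlgebra.ι ℝ) ^ (n + 1) * (⊤ * ⊤) := by
        simp only [augIdeal, pow_succ, mul_assoc]
      _ ≤ _ := mul_le_mul' le_rfl h

/-- The exterior power of degree `q + 1` of `ℝ^q` has dimension `choose q (q + 1) = 0`. -/
theorem augIdeal_pow_eq_bot : augIdeal q ^ (q + 1) = ⊥ := by
  have h : (LinearMap.range (ExteriorAlgebra.ι ℝ (M := Fin q → ℝ))) ^ (q + 1) = ⊥ := by
    have h := exteriorPower.finrank_eq (R := ℝ) (M := Fin q → ℝ) (q + 1)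
    rw [Module.finrank_fin_fun, Nat.choose_succ_self] at h
    exact Submodule.finrank_eq_zero.1 h
  have h' := augIdeal_pow_le (q := q) (q + 1)
  rw [h, Submodule.bot_mul] at h'
  exact le_bot_iff.1 h'

end Grassmann

section Model

variable {p q : ℕ} {V W : Opens (EuclideanSpace ℝ (Fin p))}

/-- The reduction of a superfunction to a smooth function. -/
def body : Model q V →ₐ[ℝ] Smooth V :=
  (Algebra.TensorProduct.rid ℝ ℝ (Smooth V)).toAlgHom.comp
    (Algebra.TensorProduct.map (AlgHom.id ℝ (Smooth V)) ExteriorAlgebra.algebraMapInv)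

theorem body_tmul (f : Smooth V) (a : Grassmann q) :
    body (f ⊗ₜ a) = ExteriorAlgebra.algebraMapInv a • f := by
  simp [body]

theorem body_modelRes (h : W ≤ V) (x : Model q V) :
    body (modelRes q h x) = smoothRes h (body x) := by
  induction x using TensorProduct.induction_on with
  | zero => simp
  | add x y hx hy => simp only [map_add, hx, hy]
  | tmul f a =>
    rw [body_tmul, map_smul, modelRes, Algebra.TensorProduct.map_tmul, body_tmul]; rfl

/-- The span of the elementary tensors with second factor in a power of the augmentation ideal. -/
def nilFiltration (q : ℕ) (V : Opens (EuclideanSpace ℝ (Fin p))) (n : ℕ) :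
    Submodule ℝ (Model q V) :=
  Submodule.span ℝ {x | ∃ (f : Smooth V) (a : Grassmann q), a ∈ augIdeal q ^ n ∧ f ⊗ₜ a = x}

theorem nilFiltration_mul_le (n : ℕ) :
    nilFiltration q V n * nilFiltration q V 1 ≤ nilFiltration q V (n + 1) := by
  rw [nilFiltration, nilFiltration, Submodule.span_mul_span]
  refine Submodule.span_mono ?_
  rintro _ ⟨_, ⟨f, a, ha, rfl⟩, _, ⟨g, b, hb, rfl⟩, rfl⟩
  refine ⟨f * g, a * b, ?_, by simp⟩
  rw [pow_succ]
  rw [pow_one] at hb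
  exact Submodule.mul_mem_mul ha hb

/-- Removing the body leaves Grassmann factors in the augmentation ideal, whose power `q + 1` is
zero. -/
theorem isNilpotent_sub_body (x : Model q V) : IsNilpotent (x - body x ⊗ₜ 1) := by
  have h1 : x - body x ⊗ₜ 1 ∈ nilFiltration q V 1 := by
    induction x using TensorProduct.induction_on with
    | zero => simp
    | add x y hx hy =>
      rw [map_add, TensorProduct.add_tmul, add_sub_add_comm]
      exact add_mem hx hy
    | tmul f a =>
      refine Submodule.subset_span ⟨f, a - algebraMap ℝ _ (ExteriorAlgebra.algebraMapInv a), ?_, ?_⟩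
      · rw [pow_one]; exact sub_algebraMapInv_mem a
      · rw [body_tmul, TensorProduct.tmul_sub, Algebra.algebraMap_eq_smul_one,
          TensorProduct.tmul_smul, TensorProduct.smul_tmul']
  have h2 : ∀ n, (x - body x ⊗ₜ 1) ^ n ∈ nilFiltration q V n := fun n => by
    induction n with
    | zero => exact Submodule.subset_span ⟨1, 1, by simp, by simp [Algebra.TensorProduct.one_def]⟩
    | succ n ih =>
      rw [pow_succ]
      exact nilFiltration_mul_le n (Submodule.mul_mem_mul ih h1)
  refine ⟨q + 1, ?_⟩
  have h3 := h2 (q + 1)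
  have h4 : nilFiltration q V (q + 1) = ⊥ := by
    rw [nilFiltration, augIdeal_pow_eq_bot, Submodule.span_eq_bot]
    rintro _ ⟨f, a, ha, rfl⟩
    rw [(Submodule.mem_bot ℝ).1 ha, TensorProduct.tmul_zero]
  rw [h4] at h3
  exact (Submodule.mem_bot ℝ).1 h3

/-- A unit plus a commuting nilpotent is a unit. -/
theorem isUnit_of_isUnit_body {x : Model q V} (h : IsUnit (body x)) : IsUnit x := by
  have hu : IsUnit (body x ⊗ₜ[ℝ] (1 : Grassmann q)) :=
    h.map (Algebra.TensorProduct.includeLeft : Smooth V →ₐ[ℝ] Model q V)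
  have hc : Commute (x - body x ⊗ₜ 1) (body x ⊗ₜ[ℝ] (1 : Grassmann q)) := by
    -- The body is made an arbitrary smooth function so that induction on `x` leaves it fixed.
    clear h hu
    generalize body x = b
    refine Commute.sub_left ?_ (Commute.refl _)
    induction x using TensorProduct.induction_on with
    | zero => exact Commute.zero_left _
    | add x y hx hy => exact hx.add_left hy
    | tmul f a => simp [Commute, SemiconjBy, mul_comm]
  have := (isNilpotent_sub_body x).isUnit_add_left_of_commute hu hc
  simpa using this

theorem Smooth.isUnit_of_ne_zero {f : Smooth V} (h : ∀ v, f v ≠ 0) : IsUnit f := by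
  refine IsUnit.of_mul_eq_one ⟨fun v => (f v)⁻¹, ?_⟩ ?_
  · exact f.contMDiff.inv₀ h
  · ext v; exact mul_inv_cancel₀ (h v)

/-- The value of a superfunction at a point. -/
def modelEval {y : EuclideanSpace ℝ (Fin p)} (hy : y ∈ V) : Model q V →+* ℝ :=
  (ContMDiffMap.evalRingHom (⟨y, hy⟩ : V) : Smooth V →+* ℝ).comp (body : Model q V →ₐ[ℝ] Smooth V)

/-- The locus where the body is nonzero is an open neighbourhood on which the body, hence the
superfunction, is invertible. -/
theorem exists_isUnit_modelRes {y : EuclideanSpace ℝ (Fin p)} (hy : y ∈ V) {x : Model q V}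
    (h : modelEval hy x ≠ 0) :
    ∃ (W : Opens (EuclideanSpace ℝ (Fin p))) (hW : W ≤ V), y ∈ W ∧ IsUnit (modelRes q hW x) := by
  have ho : IsOpen {v : V | body x v ≠ 0} :=
    isOpen_ne_fun (body x).contMDiff.continuous continuous_const
  let W : Opens (EuclideanSpace ℝ (Fin p)) :=
    ⟨Subtype.val '' {v : V | body x v ≠ 0}, V.2.isOpenMap_subtype_val _ ho⟩
  have hW : W ≤ V := by
    rintro _ ⟨v, -, rfl⟩
    exact v.2
  refine ⟨W, hW, ⟨⟨y, hy⟩, h, rfl⟩, isUnit_of_isUnit_body ?_⟩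
  rw [body_modelRes]
  refine Smooth.isUnit_of_ne_zero ?_
  rintro ⟨_, v, hv, rfl⟩
  exact hv

end Model

/-! ### Evaluation of superfunctions at points -/

namespace Chart

variable {M : SuperSpace.{u}} {p q : ℕ} (c : Chart M p q)

/-- The image of an open set under a chart. -/
def image (U : Opens M.carrier) : Opens (EuclideanSpace ℝ (Fin p)) :=
  ⟨c.homeo.target ∩ c.homeo.symm ⁻¹' U, c.homeo.symm.isOpen_inter_preimage U.2⟩

/-- The preimage of an open set under a chart. -/
def preimage (V : Opens (EuclideanSpace ℝ (Fin p))) : Opens M.carrier :=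
  ⟨c.homeo.source ∩ c.homeo ⁻¹' V, c.homeo.isOpen_inter_preimage V.2⟩

theorem image_subset (U : Opens M.carrier) : (c.image U : Set _) ⊆ c.homeo.target :=
  Set.inter_subset_left

theorem preimage_mono {V W : Opens (EuclideanSpace ℝ (Fin p))} (h : W ≤ V) :
    c.preimage W ≤ c.preimage V := fun _ hx => ⟨hx.1, h hx.2⟩

theorem preimage_image_le (U : Opens M.carrier) : c.preimage (c.image U) ≤ U := by
  rintro x ⟨hx, -, hx'⟩
  rwa [Set.mem_preimage, c.homeo.left_inv hx] at hx'

theorem mem_image {U : Opens M.carrier} {m : M.carrier} (hm : m ∈ c.homeo.source) (hU : m ∈ U) :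
    c.homeo m ∈ c.image U :=
  ⟨c.homeo.map_source hm, by rwa [Set.mem_preimage, c.homeo.left_inv hm]⟩

/-- The expression of a superfunction in a chart. -/
def expr (U : Opens M.carrier) : M.O U →+* Model q (c.image U) :=
  ((c.iso (c.image U) (c.image_subset U)).symm.toAlgHom.comp
    (SuperSpace.res (c.preimage_image_le U))).toRingHom

theorem iso_expr (U : Opens M.carrier) (f : M.O U) :
    c.iso (c.image U) (c.image_subset U) (c.expr U f) =
      SuperSpace.res (c.preimage_image_le U) f :=
  (c.iso (c.image U) (c.image_subset U)).apply_symm_apply _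

end Chart

/-- Evaluation of superfunctions at a point of a supermanifold detects local invertibility. -/
theorem Supermanifold.exists_eval {p q : ℕ} (M : Supermanifold.{u} p q) {m : M.carrier}
    {U : Opens M.carrier} (hm : m ∈ U) :
    ∃ ev : M.O U →+* ℝ, ∀ f : M.O U, ev f ≠ 0 →
      ∃ (V : Opens M.carrier) (h : V ≤ U), m ∈ V ∧ IsUnit (SuperSpace.res h f) := by
  obtain ⟨c, hc, -⟩ := M.exists_chart m
  refine ⟨(modelEval (c.mem_image hc hm)).comp (c.expr U), fun f hf => ?_⟩
  obtain ⟨W, hW, hmW, hu⟩ := exists_isUnit_modelRes (c.mem_image hc hm) hf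
  refine ⟨c.preimage W, (c.preimage_mono hW).trans (c.preimage_image_le U), ⟨hc, hmW⟩, ?_⟩
  have h1 := hu.map (c.iso W (subset_trans (SetLike.coe_subset_coe.2 hW) (c.image_subset U)))
  rw [← c.iso_res _ _ (c.image_subset U), c.iso_expr] at h1
  rw [← SuperSpace.res_res (c.preimage_image_le U) (c.preimage_mono hW)]
  exact h1

/-- On a supermanifold, a combination of superfunctions vanishing at a point is not invertible. -/
theorem Supermanifold.sum_mul_ne_one {p q : ℕ} (M : Supermanifold.{u} p q) {m : M.carrier}
    {U : Opens M.carrier} (hm : m ∈ U) {ι : Type*} (T : Finset ι) (f g : ι → M.O U)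
    (hf : ∀ i ∈ T, SuperSpace.FunVanishesAt (f i) m) : ∑ i ∈ T, f i * g i ≠ 1 := by
  obtain ⟨ev, hev⟩ := M.exists_eval hm
  intro h
  have h1 := congrArg ev h
  rw [map_sum, map_one, Finset.sum_eq_zero] at h1
  · exact zero_ne_one h1
  · intro i hi
    have h0 : ev (f i) = 0 := by
      by_contra h0
      obtain ⟨V, hV, hmV, hu⟩ := hev (f i) h0
      exact hf i hi V hV hmV hu
    rw [map_mul, h0, zero_mul]

/-- A ring homomorphism to `ℝ` excludes the zero ring, in which `0` would be a unit. -/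
theorem Supermanifold.funVanishesAt_zero {p q : ℕ} (M : Supermanifold.{u} p q) {m : M.carrier}
    (U : Opens M.carrier) : SuperSpace.FunVanishesAt (0 : M.O U) m := by
  intro V h hm hu
  obtain ⟨ev, -⟩ := M.exists_eval hm
  have := hu.map ev
  simp at this

/-! ### The Reeb vector field, locally and globally -/

open SuperSpace

variable {p q : ℕ} {M : Supermanifold.{u} p q} {α : M.OneForm}

/-- A vector field belonging to a frame vanishes nowhere. -/
theorem Supermanifold.not_vanishesAt_of_isFrame {n : ℕ} {U : Opens M.carrier}
    {X : Fin n → M.VF U} (hX : IsFrame X) (i : Fin n) {m : M.carrier} :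
    ¬ VFVanishesAt (X i) m := by
  rintro ⟨V, h, k, f, Y, hm, hf, hXi⟩
  choose c hc _ using fun l => hX.2 V h (Y l)
  obtain ⟨e, -, he⟩ := hX.2 V h (resVF h (X i))
  -- Two expansions of `X i` in the frame are compared: the tautological one, and one with
  -- coefficients `∑ f l * c l j`. Uniqueness at `j = i` gives `1 = ∑ f l * c l i`.
  have h1 : (fun j => if j = i then 1 else 0) = e := he _ <| by
    beta_reduce
    rw [Finset.sum_eq_single i]
    · rw [if_pos rfl, one_smulVF]
    · intro j _ hj; rw [if_neg hj, zero_smulVF]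
    · simp
  have h2 : (fun j => ∑ l, f l * c l j) = e := he _ <| by
    beta_reduce
    rw [hXi]
    simp only [sum_smulVF, mul_smulVF]
    rw [Finset.sum_comm]
    refine Finset.sum_congr rfl fun l _ => ?_
    conv_lhs => rw [hc l, smulVF_sum]
  have h3 := congrFun (h2.trans h1.symm) i
  rw [if_pos rfl] at h3
  exact M.sum_mul_ne_one hm _ f _ (fun l _ => hf l) h3

/-- Near every point, a contact form has a Reeb vector field, and the only vector field
in `ker α ∩ ker dα` is zero. -/
theorem IsContact.exists_local (hα : IsContact M α) (m : M.carrier) :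
    ∃ U : Opens M.carrier, m ∈ U ∧ (∃ R : M.VF U, α.contr R = 1 ∧ α.MemKerD R) ∧
      ∀ (V : Opens M.carrier), V ≤ U → ∀ Z : M.VF V, α.contr Z = 0 → α.MemKerD Z → Z = 0 := by
  obtain ⟨hnd, r, ⟨-, hr⟩, hpq⟩ := hα
  obtain ⟨U, X, Y, hm, hX, hY, hXY⟩ := hr m
  have hlt : r < p + q := by omega
  -- As `p + q = r + 1`, this is the last index, the only one whose diagonal entry is zero.
  let l : Fin (p + q) := ⟨r, hlt⟩
  have hker : α.MemKerD (X l) := fun V h Z => by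
    obtain ⟨c, hc, -⟩ := hY.2 V h Z
    rw [hc, OneForm.dContr_sum_right]
    refine Finset.sum_eq_zero fun j _ => ?_
    rw [OneForm.dContr_smul_right, OneForm.dContr_res, hXY, if_neg (by simp [l]), map_zero,
      mul_zero]
  -- Otherwise `X l` would lie in the characteristic set at `m`, and non-degeneracy would make this
  -- frame field vanish there.
  obtain ⟨V, hVU, hmV, hu⟩ : ∃ (V : Opens M.carrier) (h : V ≤ U), m ∈ V ∧
      IsUnit (res h (α.contr (X l))) := by
    by_contra hcon
    push Not at hcon
    refine M.not_vanishesAt_of_isFrame hX l (hnd m U (X l) hm ⟨hcon, fun V h _ Z => ?_⟩)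
    rw [hker V h Z]
    exact M.funVanishesAt_zero V
  refine ⟨V, hmV, ?_, fun W hW Z hZ hZk => ?_⟩
  · obtain ⟨u, hu⟩ := hu
    refine ⟨smulVF ↑u⁻¹ (resVF hVU (X l)), ?_, (hker.res hVU).smulVF _⟩
    rw [α.contr_smul, α.contr_res, ← hu, Units.inv_mul]
  · have hWU := hW.trans hVU
    obtain ⟨c, hc, -⟩ := hX.2 W hWU Z
    -- Contracting `i_Z dα` with `Y j` isolates the coefficient `c j` up to signs, so only the
    -- multiple of `X l` survives.
    have hc0 (j : Fin (p + q)) (hj : (j : ℕ) < r) : c j = 0 := by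
      obtain ⟨t, ht⟩ := hY.1 j
      have ht' : VFHasParity (resVF hWU (Y j)) t := fun t' h' => by
        rw [resVF_apply, ht t' h']; rfl
      have h1 : α.dContr (resVF hWU (X j)) (resVF hWU (Y j)) = 1 := by
        rw [OneForm.dContr_res, hXY, if_pos ⟨rfl, hj⟩, map_one]
      refine OneForm.eq_zero_of_dContr_smul_eq_zero ht' h1 ?_
      have h2 := hZk W le_rfl (resVF hWU (Y j))
      rw [show resVF le_rfl Z = Z from rfl, hc, OneForm.dContr_sum_left,
        Finset.sum_eq_single j] at h2
      · exact h2
      · intro i _ hij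
        rw [ht'.eq_ofHom, ← sum_part (c i), sum_smulVF, OneForm.dContr_sum_left]
        refine Finset.sum_eq_zero fun a _ => ?_
        rw [OneForm.dContr_smul_left α (part_mem a _), ← ht'.eq_ofHom, OneForm.dContr_res, hXY,
          if_neg (fun h => hij h.1), map_zero, mul_zero, smul_zero]
      · simp
    have hZl : Z = smulVF (c l) (resVF hWU (X l)) := by
      conv_lhs => rw [hc]
      refine Finset.sum_eq_single l (fun j _ hj => ?_) (by simp)
      have hjr : (j : ℕ) ≠ r := fun h => hj (Fin.ext h)
      rw [hc0 j (by omega), zero_smulVF]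
    rw [hZl, α.contr_smul, α.contr_res, ← res_res hVU hW] at hZ
    rw [hZl, ((hu.map (res hW)).mul_left_eq_zero).1 hZ, zero_smulVF]

theorem IsContact.eq_zero (hα : IsContact M α) {Z : M.VF ⊤} (hZ : α.contr Z = 0)
    (hZk : α.MemKerD Z) : Z = 0 := by
  choose C hmC _ hC using hα.exists_local
  refine VF.eq_zero_of_cover (fun m => ⟨m, hmC m⟩) fun m => ?_
  refine hC m (C m) le_rfl _ ?_ (hZk.res _)
  rw [α.contr_res, hZ, map_zero]

theorem IsContact.eq_of_contr_eq (hα : IsContact M α) {X Y : M.VF ⊤} (h : α.contr X = α.contr Y)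
    (hX : α.MemKerD X) (hY : α.MemKerD Y) : X = Y := by
  refine VF.eq_of_add_neg_smul (hα.eq_zero ?_ (hX.add (hY.smul _)))
  rw [map_add, map_smul, h, neg_one_smul, add_neg_cancel]

/-- Existence of the Reeb vector field of a contact form. -/
theorem IsContact.exists_reeb (hα : IsContact M α) :
    ∃ R : M.VF ⊤, α.contr R = 1 ∧ α.MemKerD R := by
  choose C hmC hR hC using hα.exists_local
  choose R hR1 hRk using hR
  have hcov : ∀ m, ∃ i, m ∈ C i := fun m => ⟨m, hmC m⟩
  -- On an overlap the difference of two local Reeb fields lies in `ker α ∩ ker dα`, hence is zero.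
  obtain ⟨S, hS⟩ := VF.exists_glue hcov R fun i j => by
    refine VF.eq_of_add_neg_smul (hC i (C i ⊓ C j) inf_le_left _ ?_ ?_)
    · rw [map_add, map_smul, α.contr_res, α.contr_res, hR1, hR1, map_one, map_one, neg_one_smul,
        add_neg_cancel]
    · exact ((hRk i).res _).add (((hRk j).res _).smul _)
  refine ⟨S, O.eq_of_cover hcov fun i => ?_, fun V h Y => O.eq_of_cover hcov fun i => ?_⟩
  · rw [← α.contr_res, map_one]
    have h1 : resVF (inf_le_left : ⊤ ⊓ C i ≤ ⊤) S = resVF inf_le_right (R i) := by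
      rw [← hS i]; rfl
    rw [h1, α.contr_res, hR1, map_one]
  · rw [← OneForm.dContr_res, map_zero]
    have h1 : resVF inf_le_left (resVF h S) = resVF (inf_le_right : V ⊓ C i ≤ C i) (R i) := by
      rw [← hS i]; rfl
    rw [h1]
    exact hRk i _ _ _

end SuperGeom
end

theorem mainTheorem6 {p q : ℕ} (M : SuperGeom.Supermanifold p q)
    (N : M.HomVF ⊤ 0) (hN : SuperGeom.IsWeightVF M N)
    (α : M.OneForm) (hα : SuperGeom.IsContact M α)
    (σ : ZMod 2) (w : ℝ) (hσ : α.HasParity σ) (hw : α.HasWeight N w) :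
    ∃ R : M.VF ⊤,
      (α.contr R = 1 ∧ α.MemKerD R) ∧
      (∀ R' : M.VF ⊤, α.contr R' = 1 ∧ α.MemKerD R' → R' = R) ∧
      (∀ m : M.carrier, ¬ SuperGeom.SuperSpace.VFVanishesAt R m) ∧
      SuperGeom.SuperSpace.VFHasParity R σ ∧
      SuperGeom.SuperSpace.VFHasWeight N R (-w) := by
  obtain ⟨R, hR1, hRk⟩ := hα.exists_reeb
  refine ⟨R, ⟨hR1, hRk⟩, fun R' h => hα.eq_of_contr_eq (h.1.trans hR1.symm) h.2 hRk, ?_, ?_, ?_⟩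
  -- If `R = ∑ f i • Y i` with all `f i` vanishing at `m`, then `1 = α(R) = ∑ f i * α(Y i)`, which
  -- is impossible.
  · rintro m ⟨V, h, k, f, Y, hm, hf, hR⟩
    refine M.sum_mul_ne_one hm Finset.univ f (fun i => α.contr (Y i)) (fun i _ => hf i) ?_
    rw [← map_one (SuperGeom.SuperSpace.res h), ← hR1, ← α.contr_res, hR, map_sum]
    simp only [α.contr_smul]
  · have h : SuperGeom.SuperSpace.ofHom σ (R σ) = R :=
      hα.eq_of_contr_eq ((hσ.contr_ofHom hR1).trans hR1.symm) (hRk.ofHom hσ σ) hRk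
    intro t ht
    rw [← h]
    exact Pi.single_eq_of_ne ht _
  -- Both `[N, R]` and `-w R` lie in `ker dα`, and both contract with `α` to `-w` because `N(1) =
  -- 0`.
  · refine hα.eq_of_contr_eq ?_ (hRk.bracket hw) (hRk.smul _)
    refine (hw.contr_bracket R).trans ?_
    rw [map_smul, hR1, SuperGeom.SuperSpace.app_one, zero_sub, neg_smul]
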